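/- Let $M$ be a matroid on a finite ground set, with circuit set $\mathcal{C}(M)$, rank function $r$ and nullity $\eta(S)=|S|-r(S)$. For a collection $\mathcal{E}$ of subsets of $\mathcal{C}(M)$ put $$\epsilon(\mathcal{E})=\mathcal{E}\cup\{(A_1\cup A_2)\setminus\{C\} : A_1,A_2\in\mathcal{E},\ A_1\cap A_2\notin\mathcal{E},\ C\in A_1\cap A_2\},$$ $${\uparrow}\mathcal{E}=\{A\subseteq\mathcal{C}(M) : A'\subseteq A \text{ for some } A'\in\mathcal{E}\}.$$ Let $\mathcal{A}_0=\{A\subseteq\mathcal{C}(M) : |A|>\eta(\bigcup_{C\in A}C)\}$, $\mathcal{A}_{i+1}={\uparrow}\epsilon(\mathcal{A}_i)$ for $i\ge 0$, and $\mathcal{A}=\bigcup_{i\ge 0}\mathcal{A}_i$. The combinatorial derived matroid $\delta M$ is the matroid on the ground set $\mathcal{C}(M)$ whose dependent sets are the elements of $\mathcal{A}$. Let $U^2_4$ denote the uniform matroid of rank $2$ on $4$ elements. **Theorem.** If $M$ is a matroid on a finite ground set with $\delta M\cong M$, then $M$ is a direct sum of finitely many (possibly zero) matroids, each of which is isomorphic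 to $U^2_4$. Moreover, $\delta U^2_4\cong U^2_4$, and the circuits of $U^2_4$ are exactly the $3$-element subsets of its ground set, that is, its circuit hypergraph is the complete $3$-regular hypergraph $K^3_4$. -/

import Mathlib

namespace DerivedMatroid

/-- The collection obtained from `𝓔` by adding all sets `(A₁ ∪ A₂) \ {v}` with `A₁, A₂ ∈ 𝓔`,
`A₁ ∩ A₂ ∉ 𝓔` and `v ∈ A₁ ∩ A₂`. -/
def eps {β : Type*} (𝓔 : Set (Set β)) : Set (Set β) :=
  𝓔 ∪ {B | ∃ A₁ ∈ 𝓔, ∃ A₂ ∈ 𝓔, A₁ ∩ A₂ ∉ 𝓔 ∧ ∃ v ∈ A₁ ∩ A₂, B = (A₁ ∪ A₂) \ {v}}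

/-- The upward closure of `𝓔` among the subsets of the ground set `V`. -/
def up {β : Type*} (V : Set β) (𝓔 : Set (Set β)) : Set (Set β) :=
  {A | A ⊆ V ∧ ∃ A' ∈ 𝓔, A' ⊆ A}

/-- The nullity `|S| - r(S)` of a set in a matroid. -/
noncomputable def nullity {α : Type*} (M : Matroid α) (S : Set α) : ℕ∞ :=
  S.encard - M.eRk S

/-- The circuit set of a matroid. -/
def circuits {α : Type*} (M : Matroid α) : Set (Set α) := {C | M.IsCircuit C}

/-- `𝓐₀` consists of the sets `A` of circuits with `|A| > η(⋃ A)`, and `𝓐ᵢ₊₁ = ↑ε(𝓐ᵢ)`. -/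
def family {α : Type*} (M : Matroid α) : ℕ → Set (Set (Set α))
  | 0 => {A | A ⊆ circuits M ∧ nullity M (⋃₀ A) < A.encard}
  | i + 1 => up (circuits M) (eps (family M i))

/-- The union `𝓐` of all the `𝓐ᵢ`. -/
def depFamily {α : Type*} (M : Matroid α) : Set (Set (Set α)) := ⋃ i, family M i

/-- Augmentation for the complement of a collection of sets that satisfies the axioms for the
dependent sets of a matroid. -/
theorem aug_of_dep {β : Type*} {E : Set β} (hE : E.Finite) {D : Set (Set β)}
    (hup : ∀ ⦃A B⦄, A ∈ D → A ⊆ B → B ⊆ E → B ∈ D)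
    (helim : ∀ ⦃A B⦄, A ∈ D → B ∈ D → A ∩ B ∉ D → ∀ v ∈ A ∩ B, (A ∪ B) \ {v} ∈ D)
    {I J : Set β} (hI : I ⊆ E ∧ I ∉ D) (hJ : J ⊆ E ∧ J ∉ D) (hIJ : I.ncard < J.ncard) :
    ∃ e ∈ J, e ∉ I ∧ (insert e I ⊆ E ∧ insert e I ∉ D) := by
  classical
  by_contra hcon
  push Not at hcon
  have hex : ∃ n : ℕ, ∃ K, K ⊆ I ∪ J ∧ K ∉ D ∧ I.ncard < K.ncard ∧ (I \ K).ncard = n :=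
    ⟨_, J, Set.subset_union_right, hJ.2, hIJ, rfl⟩
  obtain ⟨K, hKs, hKD, hKc, hKn⟩ := Nat.find_spec hex
  have hmin : ∀ T, T ⊆ I ∪ J → I.ncard < T.ncard → (I \ T).ncard < (I \ K).ncard → T ∈ D := by
    intro T hT hTc hlt
    by_contra hTD
    exact Nat.find_min hex (hKn ▸ hlt) ⟨T, hT, hTD, hTc, rfl⟩
  have hIJE : I ∪ J ⊆ E := Set.union_subset hI.1 hJ.1
  have hKE : K ⊆ E := hKs.trans hIJE
  have hKf : K.Finite := hE.subset hKE
  have hIf : I.Finite := hE.subset hI.1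
  obtain ⟨g, hgK, hgI⟩ : ∃ g ∈ K, g ∉ I := Set.exists_mem_notMem_of_ncard_lt_ncard hKc hIf
  obtain ⟨e, heI, heK⟩ : ∃ e ∈ I, e ∉ K := by
    by_contra hno
    push Not at hno
    have hgJ : g ∈ J := (hKs hgK).resolve_left hgI
    have hins : insert g I ⊆ E := Set.insert_subset (hKE hgK) hI.1
    have := hcon g hgJ hgI hins
    exact hKD (hup this (Set.insert_subset hgK hno) hKE)
  have hT : ∀ f ∈ K, f ∉ I → insert e K \ {f} ∈ D := by
    intro f hfK hfI
    have hef : e ≠ f := fun h => hfI (h ▸ heI)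
    apply hmin
    · exact Set.sdiff_subset.trans (Set.insert_subset (Or.inl heI) hKs)
    · rw [Set.ncard_sdiff_singleton_of_mem (Set.mem_insert_of_mem _ hfK),
        Set.ncard_insert_of_notMem heK hKf]
      simpa using hKc
    · apply Set.ncard_lt_ncard _ (hIf.subset Set.sdiff_subset)
      refine ⟨?_, fun h => ?_⟩
      · rintro x ⟨hxI, hx⟩
        refine ⟨hxI, fun hxK => hx ⟨Or.inr hxK, ?_⟩⟩
        rintro rfl
        exact hfI hxI
      · exact (h ⟨heI, heK⟩).2 ⟨Or.inl rfl, hef⟩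
  have heE : insert e K ⊆ E := Set.insert_subset (hI.1 heI) hKE
  have key : ∀ F : Set β, F.Finite → F ⊆ K \ I → insert e K \ F ∈ D := by
    intro F hF
    induction F, hF using Set.Finite.induction_on with
    | empty =>
      intro _
      rw [Set.sdiff_empty]
      exact hup (hT g hgK hgI) Set.sdiff_subset heE
    | @insert h F hhF _ ih =>
      intro hsub
      have hh : h ∈ K \ I := hsub (Set.mem_insert _ _)
      have hFs : F ⊆ K \ I := (Set.subset_insert _ _).trans hsub
      have h1 := ih hFs
      have h2 := hT h hh.1 hh.2
      have hint : (insert e K \ F) ∩ (insert e K \ {h}) = insert e K \ insert h F := by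
        ext x
        simp only [Set.mem_inter_iff, Set.mem_sdiff, Set.mem_insert_iff, Set.mem_singleton_iff]
        tauto
      by_contra hn
      rw [← hint] at hn
      have heF : e ∉ F := fun h => heK (hFs h).1
      have heh : e ≠ h := fun h' => heK (h' ▸ hh.1)
      have h3 := helim h1 h2 hn e ⟨⟨Or.inl rfl, heF⟩, Or.inl rfl, heh⟩
      refine hKD (hup h3 ?_ hKE)
      rintro x ⟨hx | hx, hxe⟩
      · exact hx.1.resolve_left hxe
      · exact hx.1.resolve_left hxe
  refine hI.2 (hup (key (K \ I) (hKf.subset Set.sdiff_subset) subset_rfl) ?_ hI.1)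
  rintro x ⟨hx | hx, hxn⟩
  · exact hx ▸ heI
  · by_contra hxI
    exact hxn ⟨hx, hxI⟩

theorem family_subset {α : Type*} (M : Matroid α) (i : ℕ) {A : Set (Set α)}
    (hA : A ∈ family M i) : A ⊆ circuits M := by
  cases i with
  | zero => exact hA.1
  | succ i => exact hA.1

theorem family_mono {α : Type*} (M : Matroid α) : Monotone (family M) :=
  monotone_nat_of_le_succ fun i A hA => ⟨family_subset M i hA, A, Or.inl hA, subset_rfl⟩

theorem family_nonempty {α : Type*} (M : Matroid α) (i : ℕ) : ∅ ∉ family M i := by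
  induction i with
  | zero => simp [family]
  | succ i ih =>
    rintro ⟨-, A, hA, hA0⟩
    obtain rfl := Set.subset_empty_iff.1 hA0
    rcases hA with hA | ⟨A₁, h₁, A₂, h₂, hn, v, hv, h⟩
    · exact ih hA
    · have hs : A₁ ∪ A₂ ⊆ {v} := Set.sdiff_eq_empty.1 h.symm
      have e₁ : A₁ = {v} := (Set.subset_union_left.trans hs).antisymm (by simpa using hv.1)
      have e₂ : A₂ = {v} := (Set.subset_union_right.trans hs).antisymm (by simpa using hv.2)
      subst e₁ e₂
      exact hn (by simpa using h₁)

theorem depFamily_up {α : Type*} (M : Matroid α) ⦃A B : Set (Set α)⦄ (hA : A ∈ depFamily M)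
    (hAB : A ⊆ B) (hB : B ⊆ circuits M) : B ∈ depFamily M := by
  obtain ⟨i, hi⟩ := Set.mem_iUnion.1 hA
  exact Set.mem_iUnion.2 ⟨i + 1, hB, A, Or.inl hi, hAB⟩

theorem depFamily_elim {α : Type*} (M : Matroid α) ⦃A B : Set (Set α)⦄ (hA : A ∈ depFamily M)
    (hB : B ∈ depFamily M) (hn : A ∩ B ∉ depFamily M) (v : Set α) (hv : v ∈ A ∩ B) :
    (A ∪ B) \ {v} ∈ depFamily M := by
  obtain ⟨i, hi⟩ := Set.mem_iUnion.1 hA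
  obtain ⟨j, hj⟩ := Set.mem_iUnion.1 hB
  have hi' := family_mono M (le_max_left i j) hi
  have hj' := family_mono M (le_max_right i j) hj
  refine Set.mem_iUnion.2 ⟨max i j + 1, ?_, _, Or.inr ⟨A, hi', B, hj', ?_, v, hv, rfl⟩, subset_rfl⟩
  · exact Set.sdiff_subset.trans
      (Set.union_subset (family_subset M _ hi') (family_subset M _ hj'))
  · exact fun h => hn (Set.mem_iUnion.2 ⟨_, h⟩)

theorem circuits_finite {α : Type*} (M : Matroid α) [M.Finite] : (circuits M).Finite :=
  M.ground_finite.finite_subsets.subset fun _ hC => hC.subset_ground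

/-- The combinatorial derived matroid `δM` of a finite matroid `M`: its ground set is the set of
circuits of `M`, and its dependent sets are the members of `𝓐` (see `derived_dep_iff`). -/
noncomputable def derived {α : Type*} (M : Matroid α) [M.Finite] : Matroid (Set α) :=
  (IndepMatroid.ofFinite (circuits_finite M) (fun A => A ⊆ circuits M ∧ A ∉ depFamily M)
    ⟨Set.empty_subset _, fun h => by
      obtain ⟨i, hi⟩ := Set.mem_iUnion.1 h
      exact family_nonempty M i hi⟩
    (fun _ _ hJ hIJ => ⟨hIJ.trans hJ.1, fun h => hJ.2 (depFamily_up M h hIJ hJ.1)⟩)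
    (fun _ _ hI hJ h =>
      aug_of_dep (circuits_finite M) (depFamily_up M) (depFamily_elim M) hI hJ h)
    (fun _ hI => hI.1)).matroid

theorem derived_ground {α : Type*} (M : Matroid α) [M.Finite] :
    (derived M).E = circuits M := rfl

theorem derived_dep_iff {α : Type*} (M : Matroid α) [M.Finite] (A : Set (Set α)) :
    (derived M).Dep A ↔ A ∈ depFamily M := by
  have h : A ∈ depFamily M → A ⊆ circuits M := fun h => by
    obtain ⟨i, hi⟩ := Set.mem_iUnion.1 h
    exact family_subset M i hi
  change ¬ (A ⊆ circuits M ∧ A ∉ depFamily M) ∧ A ⊆ circuits M ↔ _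
  tauto

/-- The uniform matroid of rank `min r n` on the `n`-element set `Fin n`: a set is independent
if and only if it has at most `r` elements. -/
noncomputable def uniform (r n : ℕ) : Matroid (Fin n) :=
  (IndepMatroid.ofFinite (Set.finite_univ (α := Fin n)) (fun I => I.ncard ≤ r)
    (by simp)
    (fun _ J hJ hIJ => (Set.ncard_le_ncard hIJ J.toFinite).trans hJ)
    (fun I J _ hJ h => by
      obtain ⟨e, he, heI⟩ := Set.exists_mem_notMem_of_ncard_lt_ncard h I.toFinite
      refine ⟨e, he, heI, ?_⟩
      rw [Set.ncard_insert_of_notMem heI I.toFinite]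
      omega)
    (fun _ _ => Set.subset_univ _)).matroid

/-- Two matroids are isomorphic if there is a bijection of their ground sets that preserves
independence in both directions. -/
def Isomorphic {α β : Type*} (M : Matroid α) (N : Matroid β) : Prop :=
  ∃ e : M.E ≃ N.E, ∀ I : Set M.E,
    M.Indep (Subtype.val '' I) ↔ N.Indep (Subtype.val '' (e '' I))

/-- `M` is the direct sum of finitely many (possibly zero) matroids with pairwise disjoint
ground sets, each of which is isomorphic to `N`. -/
def IsDirectSumOfCopies {α β : Type*} (M : Matroid α) (N : Matroid β) : Prop :=
  ∃ (k : ℕ) (P : Fin k → Matroid α)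
    (h : Pairwise fun i j => Disjoint (P i).E (P j).E),
    M = Matroid.disjointSigma P h ∧ ∀ i, Isomorphic (P i) N

end DerivedMatroid

/-! Only two facts about `δM` are needed: more circuits than the nullity of their union are
dependent, and every dependent set has at least three members (`three_le_ncard_of_mem_family`). An
isomorphism gives a bijection `f` from circuits to elements. By the second fact every circuit of `M`
has at least three elements, so `M` is simple.

If two circuits meet, `f` sends them into the same component (`component_eq_of_inter_nonempty`).
Hence `f` induces a permutation `h` of the components, and the elements of `h K` correspond to the
circuits inside `K`. Write `c` for nullity and `r` for rank. The first fact gives `r(h K) ≤ c(K)`,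
and an ear decomposition gives `|h K| ≥ c(K)(c(K)+1)/2`. With `r ≥ 2` everywhere this yields `|h K|
≥ 2c(K)`. Since `h` permutes the components, the sum of `|h K|` is the sum of `r(h K) + c(K)`, which
is at most the sum of `2c(K)`. All these inequalities are therefore equalities, and `c ≤ 3`.

The case `c(K) = 3` would make `h K` a simple connected matroid of rank 3 on six elements with
exactly six circuits, excluded by a parity count (`ConnSet.ncard_ne_six`). So every component is
simple of rank 2 on four elements, that is, `U²₄`. -/

namespace DerivedMatroid

open Set

variable {α : Type*} {M : Matroid α}

/-- The rank of a set as a natural number. -/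
noncomputable def rkNat (M : Matroid α) (S : Set α) : ℕ := (M.eRk S).toNat

/-- The nullity of a set as a natural number. -/
noncomputable def nul (M : Matroid α) (S : Set α) : ℕ := S.ncard - rkNat M S

/-! ### Nullity and circuits -/

section Nullity

variable [M.Finite] {S T C : Set α}

theorem finite_of_subset_ground (hS : S ⊆ M.E) : S.Finite := M.ground_finite.subset hS

theorem coe_rkNat (hS : S ⊆ M.E) : (rkNat M S : ℕ∞) = M.eRk S := by
  refine ENat.natCast_toNat (ne_top_of_le_ne_top ?_ (M.eRk_le_encard S))
  exact (finite_of_subset_ground hS).encard_lt_top.ne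

theorem coe_ncard (hS : S ⊆ M.E) : (S.ncard : ℕ∞) = S.encard :=
  (finite_of_subset_ground hS).cast_ncard_eq

theorem rkNat_le_ncard (hS : S ⊆ M.E) : rkNat M S ≤ S.ncard := by
  have := M.eRk_le_encard S
  rw [← coe_rkNat hS, ← coe_ncard hS] at this
  exact_mod_cast this

theorem rkNat_add_nul (hS : S ⊆ M.E) : rkNat M S + nul M S = S.ncard := by
  have := rkNat_le_ncard hS
  unfold nul
  omega

theorem nullity_eq (hS : S ⊆ M.E) : nullity M S = nul M S := by
  rw [nullity, ← coe_rkNat hS, ← coe_ncard hS, nul]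
  norm_cast

theorem _root_.Matroid.Indep.ncard_le_rkNat {I : Set α} (hI : M.Indep I) (hIS : I ⊆ S)
    (hS : S ⊆ M.E) : I.ncard ≤ rkNat M S := by
  have := hI.encard_le_eRk_of_subset hIS
  rw [← coe_rkNat hS, ← coe_ncard hI.subset_ground] at this
  exact_mod_cast this

theorem exists_indep_ncard_eq_rkNat (hS : S ⊆ M.E) :
    ∃ I, I ⊆ S ∧ M.Indep I ∧ I.ncard = rkNat M S := by
  obtain ⟨I, hI⟩ := M.exists_isBasis S
  refine ⟨I, hI.subset, hI.indep, ?_⟩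
  have := hI.encard_eq_eRk
  rw [← coe_rkNat hS, ← coe_ncard hI.indep.subset_ground] at this
  exact_mod_cast this

theorem nul_mono (hST : S ⊆ T) (hT : T ⊆ M.E) : nul M S ≤ nul M T := by
  have h := M.eRk_union_le_eRk_add_encard S (T \ S)
  have hS := hST.trans hT
  have hd : T \ S ⊆ M.E := sdiff_subset.trans hT
  rw [union_sdiff_cancel hST, ← coe_rkNat hS, ← coe_rkNat hT, ← coe_ncard hd] at h
  have h' : rkNat M T ≤ rkNat M S + (T \ S).ncard := by exact_mod_cast h
  have := ncard_sdiff_add_ncard_of_subset hST (finite_of_subset_ground hT)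
  have := rkNat_add_nul hS
  have := rkNat_add_nul hT
  omega

/-- An element of a circuit is spanned by the rest of that circuit, so deleting it keeps the rank.
-/
theorem nul_eq_nul_sdiff_singleton_add_one {x : α} (hC : M.IsCircuit C) (hCT : C ⊆ T)
    (hx : x ∈ C) (hT : T ⊆ M.E) : nul M T = nul M (T \ {x}) + 1 := by
  have hcl : x ∈ M.closure (T \ {x}) :=
    M.closure_subset_closure (sdiff_subset_sdiff_left hCT)
      (hC.mem_closure_sdiff_singleton_of_mem hx)
  have hd : T \ {x} ⊆ M.E := sdiff_subset.trans hT
  have hr : rkNat M T = rkNat M (T \ {x}) := by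
    rw [rkNat, rkNat, ← M.eRk_closure_eq (T \ {x}), ← M.closure_insert_eq_of_mem_closure hcl,
      insert_sdiff_singleton, insert_eq_of_mem (hCT hx), M.eRk_closure_eq]
  have := ncard_sdiff_singleton_add_one (hCT hx) (finite_of_subset_ground hT)
  have := rkNat_add_nul hd
  have := rkNat_add_nul hT
  omega

/-- Elements on no circuit are coloops: a basis of `S` together with `T \ S` contains no circuit. -/
theorem nul_eq_of_forall_isCircuit_subset (hST : S ⊆ T) (hT : T ⊆ M.E)
    (h : ∀ C, M.IsCircuit C → C ⊆ T → C ⊆ S) : nul M T = nul M S := by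
  refine le_antisymm ?_ (nul_mono hST hT)
  have hS := hST.trans hT
  obtain ⟨I, hIS, hI, hIc⟩ := exists_indep_ncard_eq_rkNat hS
  have hJT : I ∪ (T \ S) ⊆ T := union_subset (hIS.trans hST) sdiff_subset
  have hJ : M.Indep (I ∪ (T \ S)) := by
    rw [Matroid.indep_iff_forall_subset_not_isCircuit (hJT.trans hT)]
    intro C hCJ hC
    have hCS := h C hC (hCJ.trans hJT)
    exact hC.not_indep (hI.subset fun x hx => (hCJ hx).resolve_right fun h' => h'.2 (hCS hx))
  have h1 := hJ.ncard_le_rkNat hJT hT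
  rw [ncard_union_eq (disjoint_left.2 fun x hx h' => h'.2 (hIS hx))
    (finite_of_subset_ground (hIS.trans hS)) (finite_of_subset_ground (sdiff_subset.trans hT))]
    at h1
  have := ncard_sdiff_add_ncard_of_subset hST (finite_of_subset_ground hT)
  have := rkNat_add_nul hS
  have := rkNat_add_nul hT
  omega

theorem nul_of_indep (hS : M.Indep S) : nul M S = 0 := by
  have := hS.ncard_le_rkNat subset_rfl hS.subset_ground
  have := rkNat_add_nul hS.subset_ground
  omega

theorem nul_of_isCircuit (hC : M.IsCircuit C) : nul M C = 1 := by
  obtain ⟨x, hx⟩ := hC.nonempty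
  rw [nul_eq_nul_sdiff_singleton_add_one hC subset_rfl hx hC.subset_ground,
    nul_of_indep (hC.sdiff_singleton_indep hx)]

theorem two_le_nul_union {D : Set α} (hC : M.IsCircuit C) (hD : M.IsCircuit D) (hne : C ≠ D) :
    2 ≤ nul M (C ∪ D) := by
  obtain ⟨x, hxC, hxD⟩ : ∃ x ∈ C, x ∉ D :=
    not_subset.1 fun h => hne (hC.eq_of_subset_isCircuit hD h)
  have hE := union_subset hC.subset_ground hD.subset_ground
  rw [nul_eq_nul_sdiff_singleton_add_one hC subset_union_left hxC hE]
  have := nul_mono (S := D) (T := (C ∪ D) \ {x})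
    (fun y hy => ⟨Or.inr hy, fun h => hxD (h ▸ hy)⟩) (sdiff_subset.trans hE)
  rw [nul_of_isCircuit hD] at this
  omega

end Nullity

/-- Two elements are linked in `S` if they lie in a common circuit contained in `S`. -/
def Linked (M : Matroid α) (S : Set α) (e f : α) : Prop :=
  ∃ C, M.IsCircuit C ∧ C ⊆ S ∧ e ∈ C ∧ f ∈ C

/-- A set is connected if any two of its elements lie in a common circuit contained in it. -/
def ConnSet (M : Matroid α) (S : Set α) : Prop :=
  ∀ e ∈ S, ∀ f ∈ S, e ≠ f → Linked M S e f

/-! ### Connectivity, ear decompositions and lower bounds for the number of circuits -/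

section Linked

variable {S T : Set α} {e f g : α}

theorem Linked.symm (h : Linked M S e f) : Linked M S f e := by
  obtain ⟨C, hC, hCS, he, hf⟩ := h
  exact ⟨C, hC, hCS, hf, he⟩

theorem Linked.mono (h : Linked M S e f) (hST : S ⊆ T) : Linked M T e f := by
  obtain ⟨C, hC, hCS, he, hf⟩ := h
  exact ⟨C, hC, hCS.trans hST, he, hf⟩

/-- Among meeting circuits `C ∋ e` and `D ∋ g` take a pair with smallest union. Strong elimination
of a common element `x` from both sides gives `C' ∋ e` and `D' ∋ g` that avoid `x`; minimality
forces them to meet and yet to cover `x`. -/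
theorem Linked.trans [M.Finite] (hef : Linked M S e f) (hfg : Linked M S f g) :
    Linked M S e g := by
  classical
  by_contra hcon
  have hex : ∃ n : ℕ, ∃ C D, M.IsCircuit C ∧ M.IsCircuit D ∧ C ⊆ S ∧ D ⊆ S ∧ e ∈ C ∧ g ∈ D ∧
      (C ∩ D).Nonempty ∧ (C ∪ D).ncard = n := by
    obtain ⟨C, hC, hCS, he, hf⟩ := hef
    obtain ⟨D, hD, hDS, hf', hg⟩ := hfg
    exact ⟨_, C, D, hC, hD, hCS, hDS, he, hg, ⟨f, hf, hf'⟩, rfl⟩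
  obtain ⟨C, D, hC, hD, hCS, hDS, he, hg, ⟨x, hxC, hxD⟩, hn⟩ := Nat.find_spec hex
  have hmin : ∀ C' D', M.IsCircuit C' → M.IsCircuit D' → C' ∪ D' ⊆ C ∪ D → e ∈ C' → g ∈ D' →
      (C' ∩ D').Nonempty → C' ∪ D' = C ∪ D := by
    intro C' D' hC' hD' hsub he' hg' hi
    have hCD : C ∪ D ⊆ S := union_subset hCS hDS
    refine eq_of_subset_of_ncard_le hsub ?_
      (finite_of_subset_ground (union_subset hC.subset_ground hD.subset_ground))
    rw [hn]
    exact Nat.find_min' hex ⟨C', D', hC', hD', (subset_union_left.trans hsub).trans hCD,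
      (subset_union_right.trans hsub).trans hCD, he', hg', hi, rfl⟩
  have heD : e ∉ D := fun h => hcon ⟨D, hD, hDS, h, hg⟩
  have hgC : g ∉ C := fun h => hcon ⟨C, hC, hCS, he, h⟩
  obtain ⟨C', hC'sub, hC', heC'⟩ := hC.strong_elimination hD hxC hxD he heD
  obtain ⟨D', hD'sub, hD', hgD'⟩ := hD.strong_elimination hC hxD hxC hg hgC
  have h1 : ∃ y ∈ C', y ∉ C := not_subset.1 fun h =>
    (hC'sub (hC'.eq_of_subset_isCircuit hC h ▸ hxC)).2 rfl
  have h2 : ∃ y ∈ D', y ∉ D := not_subset.1 fun h =>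
    (hD'sub (hD'.eq_of_subset_isCircuit hD h ▸ hxD)).2 rfl
  obtain ⟨y, hyC', hyC⟩ := h1
  obtain ⟨z, hzD', hzD⟩ := h2
  have hyD : y ∈ D := (hC'sub hyC').1.resolve_left hyC
  have hzC : z ∈ C := (hD'sub hzD').1.resolve_left hzD
  have hC'u : C' ⊆ C ∪ D := hC'sub.trans sdiff_subset
  have hD'u : D' ⊆ C ∪ D := (hD'sub.trans sdiff_subset).trans (union_comm D C).subset
  -- `C` and `D'` meet in `z`, so `C ∪ D'` is all of `C ∪ D`; this places `y` in `D'`, and `C'` and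
  -- `D'` meet there.
  have e2 := hmin C D' hC hD' (union_subset subset_union_left hD'u) he hgD' ⟨z, hzC, hzD'⟩
  have hyD' : y ∈ D' := (e2.symm.subset (Or.inr hyD)).resolve_left hyC
  have e3 := hmin C' D' hC' hD' (union_subset hC'u hD'u) heC' hgD' ⟨y, hyC', hyD'⟩
  rcases e3.symm.subset (Or.inl hxC) with h | h
  · exact (hC'sub h).2 rfl
  · exact (hD'sub h).2 rfl

theorem Linked.mem_ground (h : Linked M S e f) : e ∈ M.E := by
  obtain ⟨C, hC, -, he, -⟩ := h
  exact hC.subset_ground he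

theorem ConnSet.singleton (e : α) : ConnSet M {e} := by
  rintro x rfl y rfl h
  exact (h rfl).elim

theorem ConnSet.union_isCircuit [M.Finite] {C : Set α} (hS : ConnSet M S) (hC : M.IsCircuit C)
    (h : (S ∩ C).Nonempty) : ConnSet M (S ∪ C) := by
  obtain ⟨s, hs, hsC⟩ := h
  have key : ∀ x ∈ S ∪ C, Linked M (S ∪ C) x s := by
    rintro x (hx | hx)
    · rcases eq_or_ne x s with rfl | hne
      · exact ⟨C, hC, subset_union_right, hsC, hsC⟩
      · exact (hS x hx s hs hne).mono subset_union_left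
    · exact ⟨C, hC, subset_union_right, hx, hsC⟩
  exact fun e he f hf _ => (key e he).trans (key f hf).symm

/-- A circuit that meets `S` in a proper nonempty part can be replaced by one whose part outside `S`
is minimal; adding it to `S` raises the nullity by one. -/
theorem exists_isCircuit_nul_union_eq [M.Finite] {C : Set α} (hS : S ⊆ M.E) (hC : M.IsCircuit C)
    (hCS : ¬ C ⊆ S) (hne : (S ∩ C).Nonempty) :
    ∃ D, M.IsCircuit D ∧ D ⊆ S ∪ C ∧ ¬ D ⊆ S ∧ (S ∩ D).Nonempty ∧
      nul M (S ∪ D) = nul M S + 1 := by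
  classical
  have hex : ∃ n : ℕ, ∃ D, M.IsCircuit D ∧ D ⊆ S ∪ C ∧ ¬ D ⊆ S ∧ (S ∩ D).Nonempty ∧
      (D \ S).ncard = n := ⟨_, C, hC, subset_union_right, hCS, hne, rfl⟩
  obtain ⟨D, hD, hDsub, hDS, hDne, hDn⟩ := Nat.find_spec hex
  refine ⟨D, hD, hDsub, hDS, hDne, ?_⟩
  obtain ⟨x, hxD, hxS⟩ := not_subset.1 hDS
  have hE : S ∪ D ⊆ M.E := union_subset hS hD.subset_ground
  -- Deleting `x` costs one unit of nullity. By minimality of `D \ S`, every circuit that survives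
  -- lies in `S`, so the nullity left is that of `S`.
  rw [nul_eq_nul_sdiff_singleton_add_one hD subset_union_right hxD hE]
  congr 1
  refine nul_eq_of_forall_isCircuit_subset
    (fun y hy => ⟨Or.inl hy, fun h => hxS (h ▸ hy)⟩) (sdiff_subset.trans hE) ?_
  intro F hF hFsub
  by_contra hFS
  have hFD : F \ S ⊆ (D \ S) \ {x} := fun y hy =>
    ⟨⟨(hFsub hy.1).1.resolve_left hy.2, hy.2⟩, (hFsub hy.1).2⟩
  have hFne : (S ∩ F).Nonempty := by
    by_contra hemp
    have hsub : F ⊆ D := fun y hy =>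
      (hFD ⟨hy, fun h => hemp ⟨y, h, hy⟩⟩).1.1
    have := hF.eq_of_subset_isCircuit hD hsub
    exact (hFsub (this ▸ hxD)).2 rfl
  have hle := Nat.find_min' hex ⟨F, hF, fun y hy => (hFsub hy).1.elim Or.inl (fun h => hDsub h),
    hFS, hFne, rfl⟩
  rw [← hDn] at hle
  have hfin : (D \ S).Finite := finite_of_subset_ground (sdiff_subset.trans hD.subset_ground)
  have h1 := ncard_le_ncard hFD (hfin.subset sdiff_subset)
  have h2 := ncard_sdiff_singleton_lt_of_mem (s := D \ S) ⟨hxD, hxS⟩ hfin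
  omega

theorem ConnSet.exists_ear [M.Finite] (hS : ConnSet M S) (hT : ConnSet M T) (hST : S ⊆ T)
    (hne : S.Nonempty) (hTS : ¬ T ⊆ S) (hTE : T ⊆ M.E) :
    ∃ S', S ⊆ S' ∧ S' ⊆ T ∧ ¬ S' ⊆ S ∧ ConnSet M S' ∧ nul M S' = nul M S + 1 := by
  obtain ⟨s, hs⟩ := hne
  obtain ⟨t, htT, htS⟩ := not_subset.1 hTS
  obtain ⟨C, hC, hCT, hsC, htC⟩ := hT s (hST hs) t htT (fun h => htS (h ▸ hs))
  obtain ⟨D, hD, hDsub, hDS, hDne, hn⟩ := exists_isCircuit_nul_union_eq (hST.trans hTE) hC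
    (fun h => htS (h htC)) ⟨s, hs, hsC⟩
  exact ⟨S ∪ D, subset_union_left, union_subset hST (hDsub.trans (union_subset hST hCT)),
    fun h => hDS (subset_union_right.trans h), hS.union_isCircuit hD hDne, hn⟩

/-- Induction along an ear decomposition of a connected set. -/
theorem ConnSet.ear_induction [M.Finite] {P : Set α → Prop} (hT : ConnSet M T)
    (hTE : T ⊆ M.E) (he : e ∈ T) (h0 : P {e})
    (hstep : ∀ S S', S ⊆ S' → S' ⊆ T → ¬ S' ⊆ S → e ∈ S → ConnSet M S → ConnSet M S' →
      nul M S' = nul M S + 1 → P S → P S') : P T := by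
  have hfin : {S | S ⊆ T ∧ e ∈ S ∧ ConnSet M S ∧ P S}.Finite :=
    (finite_of_subset_ground hTE).finite_subsets.subset fun S hS => hS.1
  obtain ⟨S, hS⟩ := hfin.exists_maximal
    ⟨{e}, singleton_subset_iff.2 he, rfl, ConnSet.singleton e, h0⟩
  obtain ⟨hST, heS, hSc, hP⟩ := hS.prop
  by_cases hTS : T ⊆ S
  · rwa [hTS.antisymm hST]
  obtain ⟨S', hSS', hS'T, hn, hc, hnul⟩ := hSc.exists_ear hT hST ⟨e, heS⟩ hTS hTE
  exact (hn (hS.le_of_ge ⟨hS'T, hSS' heS, hc, hstep S S' hSS' hS'T hn heS hSc hc hnul hP⟩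
    hSS')).elim

theorem finite_setOf_isCircuit [M.Finite] (p : Set α → Prop) :
    {C | M.IsCircuit C ∧ p C}.Finite :=
  (circuits_finite M).subset fun _ h => h.1

/-- Each ear raises the nullity by one and creates a new circuit through `e`, namely one joining `e`
to an element of the ear. -/
theorem ConnSet.nul_le_ncard [M.Finite] (hT : ConnSet M T) (hTE : T ⊆ M.E)
    (he : e ∈ T) (hloop : M.Indep {e}) :
    nul M T ≤ {C | M.IsCircuit C ∧ C ⊆ T ∧ e ∈ C}.ncard := by
  refine hT.ear_induction (P := fun T => nul M T ≤ {C | M.IsCircuit C ∧ C ⊆ T ∧ e ∈ C}.ncard)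
    hTE he (by simp [nul_of_indep hloop]) ?_
  intro S S' hSS' hS'T hn heS hS hS' hnul hP
  obtain ⟨x, hxS', hxS⟩ := not_subset.1 hn
  obtain ⟨C, hC, hCS', heC, hxC⟩ := hS' e (hSS' heS) x hxS' (fun h => hxS (h ▸ heS))
  rw [hnul]
  refine Nat.succ_le_of_lt (hP.trans_lt (ncard_lt_ncard ?_ (finite_setOf_isCircuit _)))
  have hsub : {C | M.IsCircuit C ∧ C ⊆ S ∧ e ∈ C} ⊆ {C | M.IsCircuit C ∧ C ⊆ S' ∧ e ∈ C} :=
    fun D hD => ⟨hD.1, hD.2.1.trans hSS', hD.2.2⟩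
  exact (ssubset_iff_of_subset hsub).2 ⟨C, ⟨hC, hCS', heC⟩, fun h => hxS (h.2.1 hxC)⟩

theorem ncard_add_ncard_le [M.Finite] (hST : S ⊆ T) (he : e ∉ S) :
    {C | M.IsCircuit C ∧ C ⊆ S}.ncard + {C | M.IsCircuit C ∧ C ⊆ T ∧ e ∈ C}.ncard ≤
      {C | M.IsCircuit C ∧ C ⊆ T}.ncard := by
  have hdisj : Disjoint {C | M.IsCircuit C ∧ C ⊆ S} {C | M.IsCircuit C ∧ C ⊆ T ∧ e ∈ C} :=
    disjoint_left.2 fun C hC hC' => he (hC.2 hC'.2.2)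
  rw [← ncard_union_eq hdisj (finite_setOf_isCircuit _) (finite_setOf_isCircuit _)]
  refine ncard_le_ncard ?_ (finite_setOf_isCircuit _)
  rintro C (hC | hC)
  · exact ⟨hC.1, hC.2.trans hST⟩
  · exact ⟨hC.1, hC.2.1⟩

/-- A connected set of nullity `c` contains at least `c (c + 1) / 2` circuits. -/
theorem ConnSet.nul_mul_le_ncard [M.Finite] (hT : ConnSet M T) (hTE : T ⊆ M.E)
    (hne : T.Nonempty) (hloop : ∀ e ∈ M.E, M.Indep {e}) :
    nul M T * (nul M T + 1) ≤ 2 * {C | M.IsCircuit C ∧ C ⊆ T}.ncard := by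
  obtain ⟨e, he⟩ := hne
  refine hT.ear_induction
    (P := fun T => nul M T * (nul M T + 1) ≤ 2 * {C | M.IsCircuit C ∧ C ⊆ T}.ncard)
    hTE he (by simp [nul_of_indep (hloop e (hTE he))]) ?_
  intro S S' hSS' hS'T hn heS hS hS' hnul hP
  obtain ⟨x, hxS', hxS⟩ := not_subset.1 hn
  -- At least `nul M S + 1` circuits of `S'` pass through the new element `x`, and none of them lies
  -- in `S`.
  have h1 := hS'.nul_le_ncard (hS'T.trans hTE) hxS' (hloop x (hTE (hS'T hxS')))
  have h2 := ncard_add_ncard_le (M := M) hSS' hxS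
  rw [hnul] at h1 ⊢
  nlinarith

end Linked

/-! ### Counting circuits in rank three on six elements -/

section Count

/-- If no four-element subset of a six-element set contains two members of a family of triples,
then the four-element subsets that contain a member number three times the family. -/
theorem card_filter_add_three_mul {α : Type*} [DecidableEq α] {K : Finset α} (hK : K.card = 6)
    {𝒯 : Finset (Finset α)} (h𝒯 : 𝒯 ⊆ K.powersetCard 3)
    (hpair : ∀ Q ∈ K.powersetCard 4, ∀ T₁ ∈ 𝒯, ∀ T₂ ∈ 𝒯, T₁ ⊆ Q → T₂ ⊆ Q → T₁ = T₂) :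
    ((K.powersetCard 4).filter fun Q => ∀ T ∈ 𝒯, ¬ T ⊆ Q).card + 3 * 𝒯.card = 15 := by
  classical
  have hsup : ∀ T ∈ 𝒯, ((K \ T).image fun x => insert x T).card = 3 := by
    intro T hT
    obtain ⟨hTK, hTc⟩ := Finset.mem_powersetCard.1 (h𝒯 hT)
    rw [Finset.card_image_of_injOn, Finset.card_sdiff_of_subset hTK, hK, hTc]
    intro x hx y hy hxy
    have hxT : x ∉ T := (Finset.mem_sdiff.1 hx).2
    have : x ∈ insert y T := by
      rw [← show insert x T = insert y T from hxy]
      exact Finset.mem_insert_self _ _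
    exact (Finset.mem_insert.1 this).resolve_right hxT
  have hmem : ∀ T ∈ 𝒯, ∀ Q, Q ∈ ((K \ T).image fun x => insert x T) ↔
      Q ∈ K.powersetCard 4 ∧ T ⊆ Q := by
    intro T hT Q
    obtain ⟨hTK, hTc⟩ := Finset.mem_powersetCard.1 (h𝒯 hT)
    rw [Finset.mem_image, Finset.mem_powersetCard]
    constructor
    · rintro ⟨x, hx, rfl⟩
      obtain ⟨hxK, hxT⟩ := Finset.mem_sdiff.1 hx
      refine ⟨⟨Finset.insert_subset hxK hTK, ?_⟩, Finset.subset_insert _ _⟩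
      rw [Finset.card_insert_of_notMem hxT, hTc]
    · rintro ⟨⟨hQK, hQc⟩, hTQ⟩
      obtain ⟨x, hx⟩ : ∃ x, Q \ T = {x} := by
        rw [← Finset.card_eq_one, Finset.card_sdiff_of_subset hTQ, hQc, hTc]
      have hx' : x ∈ Q \ T := hx ▸ Finset.mem_singleton_self x
      refine ⟨x, Finset.sdiff_subset_sdiff hQK subset_rfl hx', ?_⟩
      rw [Finset.insert_eq, ← hx, Finset.sdiff_union_of_subset hTQ]
  have hbi : (𝒯.biUnion fun T => (K \ T).image fun x => insert x T) =
      (K.powersetCard 4).filter fun Q => ¬ ∀ T ∈ 𝒯, ¬ T ⊆ Q := by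
    ext Q
    simp only [Finset.mem_biUnion, Finset.mem_filter]
    push Not
    constructor
    · rintro ⟨T, hT, hQ⟩
      obtain ⟨h1, h2⟩ := (hmem T hT Q).1 hQ
      exact ⟨h1, T, hT, h2⟩
    · rintro ⟨h1, T, hT, h2⟩
      exact ⟨T, hT, (hmem T hT Q).2 ⟨h1, h2⟩⟩
  have hcard := Finset.card_biUnion (s := 𝒯) (t := fun T => (K \ T).image fun x => insert x T) (by
    intro T₁ h₁ T₂ h₂ hne
    refine Finset.disjoint_left.2 fun Q hQ₁ hQ₂ => hne ?_
    obtain ⟨hQ, hs₁⟩ := (hmem T₁ h₁ Q).1 hQ₁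
    exact hpair Q hQ T₁ h₁ T₂ h₂ hs₁ ((hmem T₂ h₂ Q).1 hQ₂).2)
  rw [hbi, Finset.sum_congr rfl hsup, Finset.sum_const, smul_eq_mul] at hcard
  have htot := Finset.card_filter_add_card_filter_not (s := K.powersetCard 4)
    (fun Q => ∀ T ∈ 𝒯, ¬ T ⊆ Q)
  rw [Finset.card_powersetCard, hK, show Nat.choose 6 4 = 15 from rfl] at htot
  omega

end Count

theorem indep_of_ncard_le_two [M.Finite] (hM : ∀ C, M.IsCircuit C → 3 ≤ C.ncard) {S : Set α}
    (hS : S ⊆ M.E) (h : S.ncard ≤ 2) : M.Indep S := by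
  rw [Matroid.indep_iff_forall_subset_not_isCircuit hS]
  intro C hCS hC
  have := hM C hC
  have := ncard_le_ncard hCS (finite_of_subset_ground hS)
  omega

theorem isCircuit_of_ncard_eq_three [M.Finite] (hM : ∀ C, M.IsCircuit C → 3 ≤ C.ncard) {S : Set α}
    (hS : S ⊆ M.E) (h : S.ncard = 3) (hd : ¬ M.Indep S) : M.IsCircuit S := by
  obtain ⟨C, hCS, hC⟩ := ((Matroid.not_indep_iff hS).1 hd).exists_isCircuit_subset
  rwa [← eq_of_subset_of_ncard_le hCS (h ▸ hM C hC) (finite_of_subset_ground hS)]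

/-- In a simple connected matroid of rank three on six elements, the number of circuits is not
six. -/
theorem ConnSet.ncard_ne_six [M.Finite] (hM : ∀ C, M.IsCircuit C → 3 ≤ C.ncard) {K : Set α}
    (hK : ConnSet M K) (hKE : K ⊆ M.E) (hK6 : K.ncard = 6) (hr : rkNat M K = 3) :
    {C | M.IsCircuit C ∧ C ⊆ K}.ncard ≠ 6 := by
  classical
  intro h6
  have hnul : nul M K = 3 := by have := rkNat_add_nul hKE; omega
  have hKf : K.Finite := finite_of_subset_ground hKE
  obtain ⟨L, rfl⟩ := hKf.exists_finset_coe
  rw [ncard_coe_finset] at hK6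
  have hE : ∀ Q : Finset α, Q ⊆ L → (Q : Set α) ⊆ M.E := fun Q hQ =>
    (Finset.coe_subset.2 hQ).trans hKE
  set 𝒯 : Finset (Finset α) := (L.powersetCard 3).filter fun T => ¬ M.Indep (T : Set α) with h𝒯
  have hcirc : ∀ T ∈ 𝒯, M.IsCircuit (T : Set α) := by
    intro T hT
    obtain ⟨hT, hd⟩ := Finset.mem_filter.1 hT
    obtain ⟨hTL, hTc⟩ := Finset.mem_powersetCard.1 hT
    exact isCircuit_of_ncard_eq_three hM (hE T hTL) (by rwa [ncard_coe_finset]) hd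
  have hpair : ∀ Q ∈ L.powersetCard 4, ∀ T₁ ∈ 𝒯, ∀ T₂ ∈ 𝒯, T₁ ⊆ Q → T₂ ⊆ Q → T₁ = T₂ := by
    intro Q hQ T₁ h₁ T₂ h₂ hs₁ hs₂
    by_contra hne
    obtain ⟨hQL, hQc⟩ := Finset.mem_powersetCard.1 hQ
    -- Two triples in `Q` force `Q` to have rank at most 2, so all four triples of `Q` are circuits.
    -- At least three more circuits pass through an element outside `Q`, which makes seven.
    have hn2 := two_le_nul_union (hcirc T₁ h₁) (hcirc T₂ h₂) (fun h => hne (Finset.coe_injective h))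
    have hmono := nul_mono (M := M) (S := (T₁ : Set α) ∪ T₂) (T := Q)
      (union_subset (Finset.coe_subset.2 hs₁) (Finset.coe_subset.2 hs₂)) (hE Q hQL)
    have hrk := rkNat_add_nul (hE Q hQL)
    rw [ncard_coe_finset, hQc] at hrk
    obtain ⟨x, hxL, hxQ⟩ : ∃ x ∈ L, x ∉ Q :=
      Finset.exists_mem_notMem_of_card_lt_card (by omega)
    have h3 := hK.nul_le_ncard hKE (Finset.mem_coe.2 hxL)
      (indep_of_ncard_le_two hM (singleton_subset_iff.2 (hKE hxL)) (by simp))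
    have hadd := ncard_add_ncard_le (M := M) (S := (Q : Set α)) (T := L) (e := x)
      (Finset.coe_subset.2 hQL) (by simpa using hxQ)
    have h4 : 4 ≤ {C | M.IsCircuit C ∧ C ⊆ (Q : Set α)}.ncard := by
      have : ((fun T : Finset α => (T : Set α)) '' (Q.powersetCard 3 : Set (Finset α))).ncard = 4 := by
        rw [ncard_image_of_injective _ Finset.coe_injective, ncard_coe_finset,
          Finset.card_powersetCard, hQc]
        rfl
      rw [← this]
      refine ncard_le_ncard ?_ (finite_setOf_isCircuit _)
      rintro _ ⟨T, hT, rfl⟩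
      obtain ⟨hTQ, hTc⟩ := Finset.mem_powersetCard.1 (Finset.mem_coe.1 hT)
      refine ⟨isCircuit_of_ncard_eq_three hM (hE T (hTQ.trans hQL)) (by rwa [ncard_coe_finset])
        fun hI => ?_, Finset.coe_subset.2 hTQ⟩
      have := hI.ncard_le_rkNat (Finset.coe_subset.2 hTQ) (hE Q hQL)
      rw [ncard_coe_finset] at this
      omega
    omega
  set 𝓕 := (L.powersetCard 4).filter fun Q => ∀ T ∈ 𝒯, ¬ T ⊆ Q with h𝓕
  have hcount : 𝓕.card + 3 * 𝒯.card = 15 := by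
    convert card_filter_add_three_mul hK6 (Finset.filter_subset _ _) hpair
  have hdisj : Disjoint 𝒯 𝓕 := by
    refine Finset.disjoint_left.2 fun T hT hT' => ?_
    exact (Finset.mem_filter.1 hT').2 T hT subset_rfl
  -- In rank 3 a circuit has at most four elements: it is a dependent triple, or a 4-set containing
  -- none.
  have heq : {C | M.IsCircuit C ∧ C ⊆ (L : Set α)} =
      (fun T : Finset α => (T : Set α)) '' ((𝒯 ∪ 𝓕 : Finset (Finset α)) : Set (Finset α)) := by
    ext C
    constructor
    · rintro ⟨hC, hCL⟩
      obtain ⟨T, rfl⟩ := (hKf.subset hCL).exists_finset_coe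
      have hTL := Finset.coe_subset.1 hCL
      refine ⟨T, ?_, rfl⟩
      have h3 := hM _ hC
      have hnul1 := nul_of_isCircuit hC
      have hrk := rkNat_add_nul hC.subset_ground
      obtain ⟨I, hIT, hI, hIc⟩ := exists_indep_ncard_eq_rkNat hC.subset_ground
      have := hI.ncard_le_rkNat (hIT.trans hCL) hKE
      rw [ncard_coe_finset] at h3 hrk
      rw [Finset.coe_union]
      rcases (by omega : T.card = 3 ∨ T.card = 4) with hc | hc
      · left
        exact Finset.mem_coe.2 (Finset.mem_filter.2
          ⟨Finset.mem_powersetCard.2 ⟨hTL, hc⟩, hC.not_indep⟩)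
      · right
        refine Finset.mem_coe.2 (Finset.mem_filter.2
          ⟨Finset.mem_powersetCard.2 ⟨hTL, hc⟩, fun T' hT' hsub => ?_⟩)
        have := (hcirc T' hT').eq_of_subset_isCircuit hC (Finset.coe_subset.2 hsub)
        have hTT := Finset.coe_injective this
        have := (Finset.mem_powersetCard.1 (Finset.mem_filter.1 hT').1).2
        rw [hTT] at this
        omega
    · rintro ⟨T, hT, rfl⟩
      rw [Finset.coe_union] at hT
      rcases hT with hT | hT
      · exact ⟨hcirc T hT, Finset.coe_subset.2
          (Finset.mem_powersetCard.1 (Finset.mem_filter.1 hT).1).1⟩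
      · obtain ⟨hT, hno⟩ := Finset.mem_filter.1 hT
        obtain ⟨hTL, hTc⟩ := Finset.mem_powersetCard.1 hT
        refine ⟨?_, Finset.coe_subset.2 hTL⟩
        have hd : ¬ M.Indep (T : Set α) := fun hI => by
          have := hI.ncard_le_rkNat (Finset.coe_subset.2 hTL) hKE
          rw [ncard_coe_finset] at this
          omega
        obtain ⟨C, hCT, hC⟩ := ((Matroid.not_indep_iff (hE T hTL)).1 hd).exists_isCircuit_subset
        obtain ⟨C, rfl⟩ := (T.finite_toSet.subset hCT).exists_finset_coe
        have hCT' := Finset.coe_subset.1 hCT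
        have h3 := hM _ hC
        rw [ncard_coe_finset] at h3
        have hc4 := Finset.card_le_card hCT'
        rcases (by omega : C.card = 3 ∨ C.card = 4) with hc | hc
        · exact (hno C (Finset.mem_filter.2 ⟨Finset.mem_powersetCard.2
            ⟨hCT'.trans hTL, hc⟩, hC.not_indep⟩) hCT').elim
        · rwa [← Finset.eq_of_subset_of_card_le hCT' (by omega)]
  rw [heq, ncard_image_of_injective _ Finset.coe_injective, ncard_coe_finset,
    Finset.card_union_of_disjoint hdisj] at h6
  -- With `t` dependent triples there are `t + (15 - 3t) = 15 - 2t` circuits, an odd number.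
  omega

/-- The connected component of an element. -/
def component (M : Matroid α) (x : α) : Set α := {y | y = x ∨ Linked M M.E x y}

/-! ### Connected components -/

section Component

variable {x y : α} {C : Set α}

theorem mem_component_self (x : α) : x ∈ component M x := Or.inl rfl

theorem component_subset_ground (hx : x ∈ M.E) : component M x ⊆ M.E := by
  rintro y (rfl | h)
  · exact hx
  · exact h.symm.mem_ground

theorem component_subset_component [M.Finite] (h : y ∈ component M x) :
    component M y ⊆ component M x := by
  rintro z (rfl | hz)
  · exact h
  · rcases h with rfl | h
    · exact Or.inr hz
    · exact Or.inr (h.trans hz)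

theorem mem_component_symm (h : y ∈ component M x) : x ∈ component M y :=
  h.elim (fun h => Or.inl h.symm) fun h => Or.inr h.symm

theorem component_eq [M.Finite] (h : y ∈ component M x) : component M y = component M x :=
  (component_subset_component h).antisymm (component_subset_component (mem_component_symm h))

theorem _root_.Matroid.IsCircuit.mem_component (hC : M.IsCircuit C) (hx : x ∈ C) (hy : y ∈ C) :
    y ∈ component M x := Or.inr ⟨C, hC, hC.subset_ground, hx, hy⟩

theorem _root_.Matroid.IsCircuit.subset_component (hC : M.IsCircuit C) (hx : x ∈ C) :
    C ⊆ component M x := fun _ hy => hC.mem_component hx hy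

theorem connSet_component [M.Finite] (x : α) : ConnSet M (component M x) := by
  intro e he f hf hne
  rw [← component_eq he] at hf
  obtain ⟨C, hC, -, heC, hfC⟩ := hf.resolve_left hne.symm
  refine ⟨C, hC, ?_, heC, hfC⟩
  rw [← component_eq he]
  exact hC.subset_component heC

end Component

/-! ### Dependent sets of the derived matroid -/

section Derived

/-- One circuit has nullity 1 and two distinct circuits have union of nullity at least 2, which
settles `𝓐₀`. In an `ε` step the two sets differ, as their intersection is not in the family; their
union has at least four members and loses one. -/
theorem three_le_ncard_of_mem_family [M.Finite] (i : ℕ) {A : Set (Set α)} (hA : A ∈ family M i) :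
    3 ≤ A.ncard := by
  induction i generalizing A with
  | zero =>
    obtain ⟨hAc, hlt⟩ := hA
    have hAf := (circuits_finite M).subset hAc
    rw [nullity_eq (sUnion_subset fun C hC => (hAc hC).subset_ground), ← hAf.cast_ncard_eq] at hlt
    have hlt' : nul M (⋃₀ A) < A.ncard := by exact_mod_cast hlt
    by_contra hcon
    rcases (by omega : A.ncard = 1 ∨ A.ncard = 2) with h | h
    · obtain ⟨C, rfl⟩ := ncard_eq_one.1 h
      rw [sUnion_singleton, nul_of_isCircuit (hAc rfl)] at hlt'
      omega
    · obtain ⟨C, D, hne, rfl⟩ := ncard_eq_two.1 h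
      have := two_le_nul_union (hAc (Or.inl rfl)) (hAc (Or.inr rfl)) hne
      rw [sUnion_pair] at hlt'
      omega
  | succ i ih =>
    obtain ⟨hAc, B, hB, hBA⟩ := hA
    have hAf := (circuits_finite M).subset hAc
    refine le_trans ?_ (ncard_le_ncard hBA hAf)
    rcases hB with hB | ⟨A₁, h₁, A₂, h₂, hn, v, hv, rfl⟩
    · exact ih hB
    have hf₁ := (circuits_finite M).subset (family_subset M i h₁)
    have hf₂ := (circuits_finite M).subset (family_subset M i h₂)
    have hne : ¬ A₂ ⊆ A₁ ∨ ¬ A₁ ⊆ A₂ := by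
      by_contra h
      push Not at h
      exact hn (by rwa [h.2.antisymm h.1, inter_self])
    have h4 : 4 ≤ (A₁ ∪ A₂).ncard := by
      rcases hne with h | h
      · have := ih h₁
        have := ncard_lt_ncard (s := A₁) (t := A₁ ∪ A₂)
          (ssubset_iff_subset_not_subset.2
            ⟨subset_union_left, fun h' => h (subset_union_right.trans h')⟩) (hf₁.union hf₂)
        omega
      · have := ih h₂
        have := ncard_lt_ncard (s := A₂) (t := A₁ ∪ A₂)
          (ssubset_iff_subset_not_subset.2
            ⟨subset_union_right, fun h' => h (subset_union_left.trans h')⟩) (hf₁.union hf₂)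
        omega
    rw [ncard_sdiff_singleton_of_mem (mem_union_left A₂ hv.1)]
    omega

theorem three_le_ncard_of_dep_derived [M.Finite] {A : Set (Set α)} (hA : (derived M).Dep A) :
    3 ≤ A.ncard := by
  obtain ⟨i, hi⟩ := mem_iUnion.1 ((derived_dep_iff M A).1 hA)
  exact three_le_ncard_of_mem_family i hi

theorem derived_dep_of_nul_lt [M.Finite] {A : Set (Set α)} (hA : A ⊆ circuits M)
    (h : nul M (⋃₀ A) < A.ncard) : (derived M).Dep A := by
  rw [derived_dep_iff]
  refine mem_iUnion.2 ⟨0, hA, ?_⟩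
  rw [nullity_eq (sUnion_subset fun C hC => (hA hC).subset_ground),
    ← ((circuits_finite M).subset hA).cast_ncard_eq]
  exact_mod_cast h

/-- Replaces the equivalence of subtypes by a function on all sets; nonemptiness of `M.E` supplies a
junk value off the circuits. -/
theorem Isomorphic.exists_bijOn [M.Finite] (h : Isomorphic (derived M) M) (hne : M.E.Nonempty) :
    ∃ f : Set α → α, BijOn f (circuits M) M.E ∧
      ∀ A ⊆ circuits M, (derived M).Indep A ↔ M.Indep (f '' A) := by
  classical
  obtain ⟨e, he⟩ := h
  obtain ⟨x₀, -⟩ := hne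
  have hf : ∀ C : (derived M).E,
      (fun C => if h : C ∈ (derived M).E then (e ⟨C, h⟩ : α) else x₀) C.1 = (e C : α) := by
    rintro ⟨C, hC⟩
    simp [hC]
  set f : Set α → α := fun C => if h : C ∈ (derived M).E then (e ⟨C, h⟩ : α) else x₀
  refine ⟨f, ⟨?_, ?_, ?_⟩, ?_⟩
  · intro C hC
    rw [hf ⟨C, hC⟩]
    exact (e ⟨C, hC⟩).2
  · intro C hC D hD hCD
    rw [hf ⟨C, hC⟩, hf ⟨D, hD⟩] at hCD
    exact congrArg Subtype.val (e.injective (Subtype.val_injective hCD))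
  · intro y hy
    refine ⟨(e.symm ⟨y, hy⟩).1, (e.symm ⟨y, hy⟩).2, ?_⟩
    rw [hf]
    simp
  · intro A hA
    have h1 : A = Subtype.val '' ((Subtype.val : (derived M).E → Set α) ⁻¹' A) := by
      rw [Subtype.image_preimage_coe, derived_ground, inter_eq_right.2 hA]
    rw [h1, he, image_image, image_image]
    simp only [hf]

end Derived

/-! ### Matroids isomorphic to their derived matroid -/

section SelfDerived

variable [M.Finite] {f : Set α → α}

theorem three_le_ncard_of_isCircuit (hf : BijOn f (circuits M) M.E)
    (hind : ∀ A ⊆ circuits M, (derived M).Indep A ↔ M.Indep (f '' A)) {C : Set α}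
    (hC : M.IsCircuit C) : 3 ≤ C.ncard := by
  have himg : f '' (circuits M ∩ f ⁻¹' C) = C := by
    rw [image_inter_preimage, hf.image_eq, inter_eq_right.2 hC.subset_ground]
  have hd : (derived M).Dep (circuits M ∩ f ⁻¹' C) := by
    refine ⟨?_, inter_subset_left⟩
    rw [hind _ inter_subset_left, himg]
    exact hC.not_indep
  have := three_le_ncard_of_dep_derived hd
  rwa [← InjOn.ncard_image (hf.injOn.mono inter_subset_left), himg] at this

/-- Elimination gives a third circuit inside `C ∪ D`. Three circuits in a set of nullity at most 2
are dependent in `δM`, and their image is a dependent triple of a matroid without smaller circuits,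
hence a circuit. -/
theorem linked_of_nul_union_le_two (hf : BijOn f (circuits M) M.E)
    (hind : ∀ A ⊆ circuits M, (derived M).Indep A ↔ M.Indep (f '' A)) {C D : Set α}
    (hC : M.IsCircuit C) (hD : M.IsCircuit D) (hne : C ≠ D) (hCD : (C ∩ D).Nonempty)
    (hnul : nul M (C ∪ D) ≤ 2) : Linked M M.E (f C) (f D) := by
  obtain ⟨q, hqC, hqD⟩ := hCD
  obtain ⟨F, hFsub, hF⟩ := hC.elimination hD hne q
  have hqF : q ∉ F := fun h => (hFsub h).2 rfl
  have hCF : C ≠ F := fun h => hqF (h ▸ hqC)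
  have hDF : D ≠ F := fun h => hqF (h ▸ hqD)
  have hA : {C, D, F} ⊆ circuits M := by
    rintro X (rfl | rfl | rfl)
    exacts [hC, hD, hF]
  have hcard : ({C, D, F} : Set (Set α)).ncard = 3 := ncard_eq_three.2 ⟨C, D, F, hne, hCF, hDF, rfl⟩
  have hdep : (derived M).Dep {C, D, F} := by
    refine derived_dep_of_nul_lt hA ?_
    have hsub : ⋃₀ {C, D, F} ⊆ C ∪ D := by
      refine sUnion_subset ?_
      rintro X (rfl | rfl | rfl)
      exacts [subset_union_left, subset_union_right, hFsub.trans sdiff_subset]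
    have := nul_mono hsub (union_subset hC.subset_ground hD.subset_ground)
    omega
  have hcirc : M.IsCircuit (f '' {C, D, F}) := by
    refine isCircuit_of_ncard_eq_three (fun C hC => three_le_ncard_of_isCircuit hf hind hC)
      ((image_mono hA).trans hf.image_eq.subset) ?_ ?_
    · rw [InjOn.ncard_image (hf.injOn.mono hA), hcard]
    · rw [← hind _ hA]
      exact hdep.not_indep
  exact ⟨_, hcirc, hcirc.subset_ground, mem_image_of_mem _ (by simp), mem_image_of_mem _ (by simp)⟩

/-- Intersecting circuits lie in the same component of the derived matroid. -/
theorem component_eq_of_inter_nonempty (hf : BijOn f (circuits M) M.E)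
    (hind : ∀ A ⊆ circuits M, (derived M).Indep A ↔ M.Indep (f '' A)) {D : Set α}
    (hD : M.IsCircuit D) (n : ℕ) {C : Set α} (hC : M.IsCircuit C) (hCD : (C ∩ D).Nonempty)
    (hn : (C \ D).ncard = n) : component M (f C) = component M (f D) := by
  induction n using Nat.strong_induction_on generalizing C with
  | _ n ih =>
    rcases eq_or_ne C D with rfl | hne
    · rfl
    obtain ⟨p, hpC, hpD⟩ := not_subset.1 fun h => hne (hC.eq_of_subset_isCircuit hD h)
    obtain ⟨X, hX, hXsub, hXC, hXne, hXnul⟩ := exists_isCircuit_nul_union_eq hC.subset_ground hD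
      (fun h => hne (hD.eq_of_subset_isCircuit hC h).symm) hCD
    rw [nul_of_isCircuit hC] at hXnul
    -- `F` is an intermediate circuit: `C ∪ F` has nullity at most 2, so `f C` and `f F` are linked,
    -- while `F \ D` is smaller than `C \ D` because it misses `p`.
    obtain ⟨F, hF, hFsub⟩ : ∃ F, M.IsCircuit F ∧ F ⊆ (C ∪ X) \ {p} := by
      by_cases hpX : p ∈ X
      · obtain ⟨F, h1, h2⟩ := hC.elimination hX (fun h => hXC h.symm.subset) p
        exact ⟨F, h2, h1⟩
      · exact ⟨X, hX, fun y hy => ⟨Or.inr hy, fun h => hpX (h ▸ hy)⟩⟩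
    have hpF : p ∉ F := fun h => (hFsub h).2 rfl
    have hFC : ¬ F ⊆ C := fun h => hpF (hF.eq_of_subset_isCircuit hC h ▸ hpC)
    have hFCD : F ⊆ C ∪ D := fun y hy => (hFsub hy).1.elim Or.inl fun h => hXsub h
    have hFnD : (F ∩ D).Nonempty := by
      obtain ⟨y, hyF, hyC⟩ := not_subset.1 hFC
      exact ⟨y, hyF, (hFCD hyF).resolve_left hyC⟩
    have hCnF : (C ∩ F).Nonempty := by
      by_contra hemp
      have hsub : F ⊆ D := fun y hy => (hFCD hy).resolve_left fun h => hemp ⟨y, h, hy⟩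
      obtain rfl := hF.eq_of_subset_isCircuit hD hsub
      exact hemp hCD
    have hlt : (F \ D).ncard < n := by
      rw [← hn]
      refine ncard_lt_ncard ?_ (finite_of_subset_ground (sdiff_subset.trans hC.subset_ground))
      refine ssubset_iff_subset_not_subset.2 ⟨fun y hy => ⟨(hFCD hy.1).resolve_right hy.2, hy.2⟩,
        fun h => hpF (h ⟨hpC, hpD⟩).1⟩
    rw [← ih _ hlt hF hFnD rfl]
    refine (component_eq (Or.inr (linked_of_nul_union_le_two hf hind hC hF
      (fun h => hFC h.symm.subset) hCnF ?_))).symm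
    have := nul_mono (S := C ∪ F) (T := C ∪ X)
      (union_subset subset_union_left (hFsub.trans sdiff_subset))
      (union_subset hC.subset_ground hX.subset_ground)
    omega

/-- Circuits in the same component of `M` lie in the same component of the derived matroid. -/
theorem component_eq_of_mem_component (hf : BijOn f (circuits M) M.E)
    (hind : ∀ A ⊆ circuits M, (derived M).Indep A ↔ M.Indep (f '' A)) {C D : Set α}
    (hC : M.IsCircuit C) (hD : M.IsCircuit D) {x y : α} (hx : x ∈ C) (hy : y ∈ D)
    (hxy : y ∈ component M x) : component M (f C) = component M (f D) := by
  rcases hxy with rfl | ⟨F, hF, -, hxF, hyF⟩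
  · exact component_eq_of_inter_nonempty hf hind hD _ hC ⟨y, hx, hy⟩ rfl
  · exact (component_eq_of_inter_nonempty hf hind hF _ hC ⟨x, hx, hxF⟩ rfl).trans
      (component_eq_of_inter_nonempty hf hind hD _ hF ⟨y, hyF, hy⟩ rfl)

/-- The bijection from circuits to elements induces a permutation of the connected components that
sends the circuits contained in a component onto the elements of its image. -/
theorem exists_bijOn_components (hf : BijOn f (circuits M) M.E)
    (hind : ∀ A ⊆ circuits M, (derived M).Indep A ↔ M.Indep (f '' A)) :
    ∃ h : Set α → Set α, BijOn h (component M '' M.E) (component M '' M.E) ∧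
      (∀ K ∈ component M '' M.E, h K = f '' {C | M.IsCircuit C ∧ C ⊆ K}) ∧
      ∀ K ∈ component M '' M.E, ∃ C, M.IsCircuit C ∧ C ⊆ K := by
  classical
  -- The default value `K` keeps `h` a self-map of the components; components without circuits are
  -- ruled out at the end by injectivity.
  let h : Set α → Set α := fun K =>
    if hK : ∃ C, M.IsCircuit C ∧ C ⊆ K then component M (f hK.choose) else K
  have hval : ∀ K ∈ component M '' M.E, ∀ C, M.IsCircuit C → C ⊆ K → h K = component M (f C) := by
    rintro _ ⟨x, hx, rfl⟩ C hC hCK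
    have hex : ∃ C, M.IsCircuit C ∧ C ⊆ component M x := ⟨C, hC, hCK⟩
    obtain ⟨hD, hDK⟩ := hex.choose_spec
    have hdef : h (component M x) = component M (f hex.choose) := dif_pos hex
    obtain ⟨y, hy⟩ := hD.nonempty
    obtain ⟨z, hz⟩ := hC.nonempty
    rw [hdef]
    refine component_eq_of_mem_component hf hind hD hC hy hz ?_
    rw [component_eq (hDK hy)]
    exact hCK hz
  have hmaps : MapsTo h (component M '' M.E) (component M '' M.E) := by
    intro K hK
    by_cases hex : ∃ C, M.IsCircuit C ∧ C ⊆ K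
    · obtain ⟨C, hC, hCK⟩ := hex
      rw [hval K hK C hC hCK]
      exact mem_image_of_mem _ (hf.mapsTo hC)
    · have : h K = K := dif_neg hex
      rwa [this]
  have hpre : ∀ y ∈ M.E, ∃ C, M.IsCircuit C ∧ f C = y ∧ ∃ K ∈ component M '' M.E, C ⊆ K ∧
      h K = component M y := by
    intro y hy
    obtain ⟨C, hC, rfl⟩ := hf.surjOn hy
    obtain ⟨x, hx⟩ := Matroid.IsCircuit.nonempty hC
    have hK := mem_image_of_mem (component M) (Matroid.IsCircuit.subset_ground hC hx)
    have hsub := Matroid.IsCircuit.subset_component hC hx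
    exact ⟨C, hC, rfl, _, hK, hsub, hval _ hK C hC hsub⟩
  -- Every element is `f C` for some circuit `C`, so every component is hit; finiteness turns
  -- surjectivity into bijectivity.
  have hsurj : SurjOn h (component M '' M.E) (component M '' M.E) := by
    rintro _ ⟨y, hy, rfl⟩
    obtain ⟨C, -, -, K, hK, -, hKy⟩ := hpre y hy
    exact ⟨K, hK, hKy⟩
  have hbij := ((M.ground_finite.image _).surjOn_iff_bijOn_of_mapsTo hmaps).1 hsurj
  refine ⟨h, hbij, fun K hK => ?_, fun K hK => ?_⟩
  · apply Subset.antisymm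
    · intro y hy
      obtain ⟨z, hz, hKz⟩ := hmaps hK
      have hyz : component M y = h K := by
        rw [← hKz] at hy ⊢
        exact component_eq hy
      obtain ⟨C, hC, rfl, K', hK', hCK', hK'y⟩ := hpre y (by
        rw [← hKz] at hy
        exact component_subset_ground hz hy)
      obtain rfl := hbij.injOn hK' hK (hK'y.trans hyz)
      exact ⟨C, ⟨hC, hCK'⟩, rfl⟩
    · rintro _ ⟨C, ⟨hC, hCK⟩, rfl⟩
      rw [hval K hK C hC hCK]
      exact mem_component_self _
  · by_contra hex
    have hKK : h K = K := dif_neg hex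
    obtain ⟨x, hx, rfl⟩ := hK
    obtain ⟨C, hC, -, K', hK', hCK', hK'x⟩ := hpre x hx
    have := hbij.injOn hK' (mem_image_of_mem _ hx) (hK'x.trans hKK.symm)
    exact hex ⟨C, hC, this ▸ hCK'⟩

/-- An independent subset of the image comes from circuits inside `K` that are independent in `δM`;
if they outnumbered the nullity of `K`, they would belong to `𝓐₀`. -/
theorem rkNat_image_le (hf : BijOn f (circuits M) M.E)
    (hind : ∀ A ⊆ circuits M, (derived M).Indep A ↔ M.Indep (f '' A)) {K : Set α} (hK : K ⊆ M.E) :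
    rkNat M (f '' {C | M.IsCircuit C ∧ C ⊆ K}) ≤ nul M K := by
  have hsub : {C | M.IsCircuit C ∧ C ⊆ K} ⊆ circuits M := fun C hC => hC.1
  obtain ⟨I, hIS, hI, hIc⟩ := exists_indep_ncard_eq_rkNat (M := M)
    ((image_mono hsub).trans hf.image_eq.subset)
  obtain ⟨A, hA, rfl⟩ := subset_image_iff.1 hIS
  have hAc := hA.trans hsub
  rw [← hind A hAc] at hI
  rw [← hIc, InjOn.ncard_image (hf.injOn.mono hAc)]
  by_contra hlt
  refine (derived_dep_of_nul_lt hAc ?_).not_indep hI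
  have := nul_mono (sUnion_subset fun C hC => (hA hC).2) hK
  omega

theorem component_ncard_and_rkNat (hf : BijOn f (circuits M) M.E)
    (hind : ∀ A ⊆ circuits M, (derived M).Indep A ↔ M.Indep (f '' A)) {x : α} (hx : x ∈ M.E) :
    (component M x).ncard = 4 ∧ rkNat M (component M x) = 2 := by
  have hM : ∀ C, M.IsCircuit C → 3 ≤ C.ncard := fun C hC => three_le_ncard_of_isCircuit hf hind hC
  obtain ⟨h, hbij, himg, hex⟩ := exists_bijOn_components hf hind
  have hfin : (component M '' M.E).Finite := M.ground_finite.image _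
  obtain ⟨s, hs⟩ := hfin.exists_finset_coe
  rw [← hs] at hbij himg hex
  have hE : ∀ K ∈ s, K ⊆ M.E := by
    intro K hK
    obtain ⟨y, hy, rfl⟩ := hs.subset (Finset.mem_coe.2 hK)
    exact component_subset_ground hy
  have hconn : ∀ K ∈ s, ConnSet M K ∧ K.Nonempty := by
    intro K hK
    obtain ⟨y, hy, rfl⟩ := hs.subset (Finset.mem_coe.2 hK)
    exact ⟨connSet_component y, y, mem_component_self y⟩
  have hmaps : ∀ K ∈ s, h K ∈ s := fun K hK => hbij.mapsTo hK
  have hrn : ∀ K ∈ s, rkNat M K + nul M K = K.ncard := fun K hK => rkNat_add_nul (hE K hK)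
  have hm : ∀ K ∈ s, (h K).ncard = {C | M.IsCircuit C ∧ C ⊆ K}.ncard := by
    intro K hK
    rw [himg K hK, InjOn.ncard_image (hf.injOn.mono fun C hC => hC.1)]
  have hrc : ∀ K ∈ s, rkNat M (h K) ≤ nul M K := by
    intro K hK
    rw [himg K hK]
    exact rkNat_image_le hf hind (hE K hK)
  have hr2 : ∀ K ∈ s, 2 ≤ rkNat M K := by
    intro K hK
    obtain ⟨C, hC, hCK⟩ := hex K hK
    obtain ⟨I, hIC, hI⟩ := exists_subset_card_eq (show 2 ≤ C.ncard by have := hM C hC; omega)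
    rw [← hI]
    exact (indep_of_ncard_le_two hM (hIC.trans hC.subset_ground) hI.le).ncard_le_rkNat
      (hIC.trans hCK) (hE K hK)
  have hc2 : ∀ K ∈ s, 2 ≤ nul M K := fun K hK => (hr2 _ (hmaps K hK)).trans (hrc K hK)
  have hcc : ∀ K ∈ s, nul M K * (nul M K + 1) ≤ 2 * (h K).ncard := by
    intro K hK
    rw [hm K hK]
    exact (hconn K hK).1.nul_mul_le_ncard (hE K hK) (hconn K hK).2 fun e he =>
      indep_of_ncard_le_two hM (singleton_subset_iff.2 he) (by simp)
  -- For nullity at least 3 this follows from `c(c+1)/2 ≥ 2c`; for nullity 2, from rank and nullity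
  -- of `h K` both being at least 2.
  have hge : ∀ K ∈ s, 2 * nul M K ≤ (h K).ncard := by
    intro K hK
    have h1 := hrn _ (hmaps K hK)
    have h2 := hr2 _ (hmaps K hK)
    have h3 := hc2 _ (hmaps K hK)
    have h4 := hcc K hK
    rcases Nat.lt_or_ge (nul M K) 3 with h5 | h5
    · omega
    · nlinarith
  have hsum : ∀ g : Set α → ℕ, ∑ K ∈ s, g (h K) = ∑ K ∈ s, g K := fun g =>
    Finset.sum_nbij h hmaps hbij.injOn hbij.surjOn fun _ _ => rfl
  have hs1 : ∑ K ∈ s, (h K).ncard = ∑ K ∈ s, rkNat M (h K) + ∑ K ∈ s, nul M K := by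
    rw [hsum ncard, hsum (rkNat M), ← Finset.sum_add_distrib]
    exact Finset.sum_congr rfl fun K hK => (hrn K hK).symm
  have hs2 : ∑ K ∈ s, rkNat M (h K) ≤ ∑ K ∈ s, nul M K := Finset.sum_le_sum hrc
  have hs3 := Finset.sum_le_sum hge
  have hs4 : ∑ K ∈ s, 2 * nul M K = 2 * ∑ K ∈ s, nul M K := (Finset.mul_sum _ _ _).symm
  -- The summed inequalities close up into a circle, so each of them is an equality termwise.
  have heq1 := (Finset.sum_eq_sum_iff_of_le hge).1 (by omega)
  have heq2 := (Finset.sum_eq_sum_iff_of_le hrc).1 (by omega)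
  have hc3 : ∀ K ∈ s, nul M K ≤ 3 := by
    intro K hK
    have h1 := hcc K hK
    have h2 := heq1 K hK
    by_contra hlt
    nlinarith
  have hc : ∀ K ∈ s, nul M K = 2 := by
    intro K hK
    by_contra hne
    have h0 : nul M K = 3 := by
      have := hc3 K hK
      have := hc2 K hK
      omega
    have h1 := heq1 K hK
    have h2 := heq2 K hK
    have h3 := hrn _ (hmaps K hK)
    have h4 := heq1 _ (hmaps K hK)
    -- Here `h K` has six elements, rank 3 and so nullity 3; the equality applied to `h K` itself
    -- gives it `2 * 3 = 6` circuits.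
    refine (hconn _ (hmaps K hK)).1.ncard_ne_six hM (hE _ (hmaps K hK)) (by omega) (by omega) ?_
    rw [← hm _ (hmaps K hK)]
    omega
  obtain ⟨K, hK, hKx⟩ := hbij.surjOn (hs.symm.subset (mem_image_of_mem (component M) hx))
  have h1 := heq1 K hK
  have h2 := heq2 K hK
  have h3 := hc K hK
  rw [hKx] at h1 h2
  omega

end SelfDerived

/-! ### The uniform matroid `U²₄` -/

section Uniform

theorem uniform_indep_iff {r n : ℕ} {I : Set (Fin n)} : (uniform r n).Indep I ↔ I.ncard ≤ r :=
  Iff.rfl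

theorem isomorphic_uniform_of_ncard {β : Type*} {N : Matroid β} {r n : ℕ} (hfin : N.E.Finite)
    (hn : N.E.ncard = n) (hind : ∀ I ⊆ N.E, N.Indep I ↔ I.ncard ≤ r) :
    Isomorphic N (uniform r n) := by
  have := hfin.to_subtype
  have e₁ : N.E ≃ Fin n := Finite.equivFinOfCardEq hn
  refine ⟨e₁.trans (Equiv.Set.univ (Fin n)).symm, fun I => ?_⟩
  rw [hind _ (Subtype.coe_image_subset _ _), uniform_indep_iff,
    ncard_image_of_injective _ Subtype.val_injective,
    ncard_image_of_injective _ Subtype.val_injective, ncard_image_of_injective _ (Equiv.injective _)]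

theorem uniform_two_four_isCircuit_iff {C : Set (Fin 4)} :
    (uniform 2 4).IsCircuit C ↔ C.ncard = 3 := by
  have hE : ∀ S : Set (Fin 4), S ⊆ (uniform 2 4).E := fun S => subset_univ S
  constructor
  · intro hC
    have h1 := hC.not_indep
    rw [uniform_indep_iff] at h1
    obtain ⟨x, hx⟩ := hC.nonempty
    have h2 := hC.sdiff_singleton_indep hx
    rw [uniform_indep_iff, ncard_sdiff_singleton_of_mem hx] at h2
    omega
  · intro hC
    have hd : (uniform 2 4).Dep C := by
      rw [← Matroid.not_indep_iff (hE C), uniform_indep_iff]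
      omega
    refine Matroid.isCircuit_iff.2 ⟨hd, fun D hD hDC => eq_of_subset_of_ncard_le hDC ?_⟩
    have := hD.not_indep
    rw [uniform_indep_iff] at this
    omega

theorem ncard_circuits_uniform_two_four : (circuits (uniform 2 4)).ncard = 4 := by
  have : circuits (uniform 2 4) = (fun T : Finset (Fin 4) => (T : Set (Fin 4))) ''
      (↑(Finset.powersetCard 3 (Finset.univ : Finset (Fin 4))) : Set (Finset (Fin 4))) := by
    ext C
    obtain ⟨T, rfl⟩ := C.toFinite.exists_finset_coe
    simp [circuits, uniform_two_four_isCircuit_iff]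
  rw [this, ncard_image_of_injective _ Finset.coe_injective, ncard_coe_finset]
  rfl

/-- The whole ground set has nullity 2, so any three circuits already lie in `𝓐₀`, while two
circuits are never dependent. -/
theorem derived_uniform_two_four : Isomorphic (derived (uniform 2 4)) (uniform 2 4) := by
  refine isomorphic_uniform_of_ncard (circuits_finite _) ncard_circuits_uniform_two_four ?_
  intro A hA
  constructor
  · intro hI
    by_contra hlt
    refine (derived_dep_of_nul_lt hA ?_).not_indep hI
    have hmono := nul_mono (M := uniform 2 4) (S := ⋃₀ A) (T := univ) (subset_univ _) subset_rfl
    have hadd := rkNat_add_nul (M := uniform 2 4) (S := univ) subset_rfl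
    obtain ⟨J, hJ⟩ : ∃ J : Set (Fin 4), J.ncard = 2 := ⟨{0, 1}, ncard_pair (by decide)⟩
    have hrk := (uniform_indep_iff.2 hJ.le : (uniform 2 4).Indep J).ncard_le_rkNat
      (subset_univ J) subset_rfl
    rw [ncard_univ, Nat.card_fin] at hadd
    omega
  · intro hle
    by_contra hI
    have := three_le_ncard_of_dep_derived ((Matroid.not_indep_iff hA).1 hI)
    omega

end Uniform

/-! ### Decomposition into components -/

theorem eq_disjointSigma {ι : Type*} {P : ι → Matroid α}
    (h : Pairwise fun i j => Disjoint (P i).E (P j).E) (hE : M.E = ⋃ i, (P i).E)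
    (hind : ∀ I ⊆ M.E, M.Indep I ↔ ∀ i, (P i).Indep (I ∩ (P i).E)) :
    M = Matroid.disjointSigma P h := by
  refine Matroid.ext_indep (hE.trans Matroid.disjointSigma_ground_eq.symm) fun I hI => ?_
  exact (hind I hI).trans
    ((and_iff_left (hE ▸ hI)).symm.trans Matroid.disjointSigma_indep_iff.symm)

theorem isDirectSumOfCopies_of_isomorphic_derived [M.Finite] (h : Isomorphic (derived M) M) :
    IsDirectSumOfCopies M (uniform 2 4) := by
  rcases M.E.eq_empty_or_nonempty with h0 | hne
  · refine ⟨0, Fin.elim0, fun i => i.elim0, ?_, fun i => i.elim0⟩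
    refine eq_disjointSigma _ (by rw [h0, iUnion_of_empty]) fun I hI => ?_
    rw [h0, subset_empty_iff] at hI
    subst hI
    simp
  obtain ⟨f, hf, hind⟩ := h.exists_bijOn hne
  have hM : ∀ C, M.IsCircuit C → 3 ≤ C.ncard := fun C hC => three_le_ncard_of_isCircuit hf hind hC
  have := (M.ground_finite.image (component M)).to_subtype
  obtain ⟨k, ⟨e⟩⟩ := Finite.exists_equiv_fin (component M '' M.E)
  have hK : ∀ i, ∃ x ∈ M.E, component M x = (e.symm i).1 := fun i => (e.symm i).2
  have hKE : ∀ i, (e.symm i).1 ⊆ M.E := by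
    intro i
    obtain ⟨x, hx, hxi⟩ := hK i
    rw [← hxi]
    exact component_subset_ground hx
  have hcover : ∀ x ∈ M.E, ∃ i, component M x = (e.symm i).1 := fun x hx =>
    ⟨e ⟨_, mem_image_of_mem _ hx⟩, by simp⟩
  refine ⟨k, fun i => M.restrict (e.symm i).1, ?_, ?_, ?_⟩
  · intro i j hij
    refine disjoint_left.2 fun y hyi hyj => hij ?_
    simp only [Matroid.restrict_ground_eq] at hyi hyj
    obtain ⟨a, -, ha⟩ := hK i
    obtain ⟨b, -, hb⟩ := hK j
    refine e.symm.injective (Subtype.ext ?_)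
    rw [← ha] at hyi ⊢
    rw [← hb] at hyj ⊢
    rw [← component_eq hyi, component_eq hyj]
  · have hEU : M.E = ⋃ i, (e.symm i).1 := by
      refine Subset.antisymm (fun x hx => ?_) (iUnion_subset hKE)
      obtain ⟨i, hi⟩ := hcover x hx
      exact mem_iUnion.2 ⟨i, hi ▸ mem_component_self x⟩
    refine eq_disjointSigma _ hEU fun I hI => ?_
    simp only [Matroid.restrict_ground_eq, Matroid.restrict_indep_iff]
    refine ⟨fun h i => ⟨h.subset inter_subset_left, inter_subset_right⟩, fun h => ?_⟩
    -- A circuit lies in a single component, so independence can be tested componentwise.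
    rw [Matroid.indep_iff_forall_subset_not_isCircuit hI]
    intro C hCI hC
    obtain ⟨x, hx⟩ := hC.nonempty
    obtain ⟨i, hi⟩ := hcover x (hC.subset_ground hx)
    exact hC.not_indep ((h i).1.subset
      (subset_inter hCI (hi ▸ hC.subset_component hx)))
  · intro i
    obtain ⟨x, hx, hxi⟩ := hK i
    obtain ⟨h4, h2⟩ := component_ncard_and_rkNat hf hind hx
    rw [hxi] at h4 h2
    refine isomorphic_uniform_of_ncard (finite_of_subset_ground (hKE i)) h4 fun I hI => ?_
    rw [Matroid.restrict_ground_eq] at hI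
    rw [Matroid.restrict_indep_iff]
    refine ⟨fun h => h2 ▸ h.1.ncard_le_rkNat hI (hKE i), fun h => ⟨?_, hI⟩⟩
    exact indep_of_ncard_le_two hM (hI.trans (hKE i)) h

end DerivedMatroid

theorem mainTheorem1 :
    (∀ (α : Type*) (M : Matroid α) [M.Finite],
      DerivedMatroid.Isomorphic (DerivedMatroid.derived M) M →
        DerivedMatroid.IsDirectSumOfCopies M (DerivedMatroid.uniform 2 4)) ∧
    DerivedMatroid.Isomorphic (DerivedMatroid.derived (DerivedMatroid.uniform 2 4))
      (DerivedMatroid.uniform 2 4) ∧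
    (∀ C : Set (Fin 4), (DerivedMatroid.uniform 2 4).IsCircuit C ↔ C.ncard = 3) := by
  exact ⟨fun _ _ _ h => DerivedMatroid.isDirectSumOfCopies_of_isomorphic_derived h,
    DerivedMatroid.derived_uniform_two_four,
    fun _ => DerivedMatroid.uniform_two_four_isCircuit_iff⟩
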